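/- Let $\mathcal{A}$ be a complex unital Banach algebra that is semiprime, i.e. $\{0\}$ is the only two-sided ideal $J$ of $\mathcal{A}$ with $J^2=\{0\}$. For a right (resp. left) ideal $J$ of $\mathcal{A}$, let $\Theta(J)\in\{0,1,2,\dots,\infty\}$ be the smallest number of minimal right (resp. left) ideals whose sum is $J$, with $\Theta(\{0\})=0$ and $\Theta(J)=\infty$ if $J$ is not a finite sum of minimal right (resp. left) ideals. For $x\in\mathcal{A}$ put $R(x)=\{a\in\mathcal{A}: xa=0\}$, $L(x)=\{a\in\mathcal{A}: ax=0\}$, $\mathrm{null}(x)=\Theta(R(x))$ and $\mathrm{def}(x)=\Theta(L(x))$. Let $\mathrm{soc}(\mathcal{A})$ be the sum of all minimal right ideals of $\mathcal{A}$ ($\{0\}$ if there are none), which is a two-sided ideal, and let $\pi:\mathcal{A}\to\mathcal{A}/\mathrm{soc}(\mathcal{A})$ be the canonical homomorphism. An element $a\in\mathcal{A}$ is Fredholm if $\pi(a)$ is invertible, and B-Fredholm if $\pi(a)$ is Drazin invertible, i.e. there are $b\in\mathcal{A}/\mathrm{soc}(\mathcal{A})$ and $k\in\mathbb{N}$ with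 $b\pi(a)b=b$, $\pi(a)b=b\pi(a)$ and $\pi(a)^k b\,\pi(a)=\pi(a)^k$. Theorem 2.6. Let $x\in\mathcal{A}$ be B-Fredholm. Then there exist $\varepsilon>0$ and $N\in\mathbb{N}$ such that $\Theta(R(x)\cap x^m\mathcal{A})$ and $\Theta(L(x)\cap\mathcal{A}x^m)$ do not depend on $m$ for $m\ge N$, and for all $\lambda\in\mathbb{C}$ with $0<|\lambda|<\varepsilon$ and all $m\ge N$: 1. $x-\lambda$ is Fredholm; 2. $\mathrm{null}(x-\lambda)=\Theta(R(x)\cap x^m\mathcal{A})\le \mathrm{null}(x)$; 3. $\mathrm{def}(x-\lambda)=\Theta(L(x)\cap\mathcal{A}x^m)\le \mathrm{def}(x)$. -/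

import Mathlib

namespace BFredholm

/-! Right ideals of a ring `R` are the submodules of `R` over `Rᵐᵒᵖ` (acting by right
multiplication); left ideals are the submodules of `R` over `R`. -/

/-- A ring is semiprime if `{0}` is the only two-sided ideal `J` with `J² = {0}`. -/
def IsSemiprimeRing (R : Type*) [Ring R] : Prop :=
  ∀ J : TwoSidedIdeal R, (∀ a ∈ J, ∀ b ∈ J, a * b = 0) → J = ⊥

/-- The order `Θ(J)`: the smallest number of minimal (nonzero) submodules whose sum is `J`,
and `⊤` if there is no such finite family. In particular the order of `0` is `0`. For `J` a right
(left) ideal the minimal submodules are the minimal right (left) ideals. -/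
noncomputable def order {S M : Type*} [Ring S] [AddCommGroup M] [Module S M]
    (J : Submodule S M) : ℕ∞ :=
  ⨅ (s : Finset (Submodule S M)) (_ : (∀ I ∈ s, IsAtom I) ∧ s.sup id = J), (s.card : ℕ∞)

section Ring

variable {R : Type*} [Ring R]

/-- The right annihilator `R(x) = {a | x a = 0}`, a right ideal. -/
def rightAnn (x : R) : Submodule Rᵐᵒᵖ R where
  carrier := {a | x * a = 0}
  add_mem' {a b} ha hb := by
    have ha : x * a = 0 := ha
    have hb : x * b = 0 := hb
    change x * (a + b) = 0
    rw [mul_add, ha, hb, add_zero]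
  zero_mem' := mul_zero x
  smul_mem' c a ha := by
    have ha : x * a = 0 := ha
    change x * (a * c.unop) = 0
    rw [← mul_assoc, ha, zero_mul]

/-- The left annihilator `L(x) = {a | a x = 0}`, a left ideal. -/
def leftAnn (x : R) : Submodule R R where
  carrier := {a | a * x = 0}
  add_mem' {a b} ha hb := by
    have ha : a * x = 0 := ha
    have hb : b * x = 0 := hb
    change (a + b) * x = 0
    rw [add_mul, ha, hb, add_zero]
  zero_mem' := zero_mul x
  smul_mem' c a ha := by
    have ha : a * x = 0 := ha
    change c * a * x = 0
    rw [mul_assoc, ha, mul_zero]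

/-- The principal right ideal `xR = {x a | a ∈ R}`. -/
def rightMul (x : R) : Submodule Rᵐᵒᵖ R where
  carrier := {b | ∃ a, x * a = b}
  add_mem' := by
    rintro _ _ ⟨a, rfl⟩ ⟨b, rfl⟩
    exact ⟨a + b, mul_add x a b⟩
  zero_mem' := ⟨0, mul_zero x⟩
  smul_mem' := by
    rintro c _ ⟨a, rfl⟩
    exact ⟨a * c.unop, (mul_assoc x a c.unop).symm⟩

/-- The principal left ideal `Rx = {a x | a ∈ R}`. -/
def leftMul (x : R) : Submodule R R where
  carrier := {b | ∃ a, a * x = b}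
  add_mem' := by
    rintro _ _ ⟨a, rfl⟩ ⟨b, rfl⟩
    exact ⟨a + b, add_mul a b x⟩
  zero_mem' := ⟨0, zero_mul x⟩
  smul_mem' := by
    rintro c _ ⟨a, rfl⟩
    exact ⟨c * a, mul_assoc c a x⟩

/-- The nullity `null(x) = Θ(R(x))`. -/
noncomputable def nullity (x : R) : ℕ∞ := order (rightAnn x)

/-- The defect `def(x) = Θ(L(x))`. -/
noncomputable def defect (x : R) : ℕ∞ := order (leftAnn x)

/-- `b` is a Drazin inverse of `a`, for some index. -/
def IsDrazinInvertible (a : R) : Prop :=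
  ∃ b : R, b * a * b = b ∧ a * b = b * a ∧ ∃ k : ℕ, a ^ k * b * a = a ^ k

variable (R) in
/-- The sum of all minimal right ideals of `R` (zero if there are none). -/
def rightSocle : Submodule Rᵐᵒᵖ R := sSup {I | IsAtom I}

/-- A left multiple of a minimal right ideal is zero or a minimal right ideal. -/
theorem map_atom (c : R) {I : Submodule Rᵐᵒᵖ R} (hI : IsAtom I) :
    I.map (DistribSMul.toLinearMap Rᵐᵒᵖ R c) = ⊥ ∨
      IsAtom (I.map (DistribSMul.toLinearMap Rᵐᵒᵖ R c)) := by
  by_cases h : I.map (DistribSMul.toLinearMap Rᵐᵒᵖ R c) = ⊥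
  · exact Or.inl h
  refine Or.inr ⟨h, fun K hK => ?_⟩
  have hle : I ⊓ K.comap (DistribSMul.toLinearMap Rᵐᵒᵖ R c) ≤ I := inf_le_left
  rcases hI.le_iff.1 hle with h0 | h1
  · rw [eq_bot_iff]
    intro y hy
    obtain ⟨z, hz, rfl⟩ := hK.le hy
    have hz0 : z ∈ I ⊓ K.comap (DistribSMul.toLinearMap Rᵐᵒᵖ R c) := ⟨hz, hy⟩
    rw [h0, Submodule.mem_bot] at hz0
    rw [hz0, map_zero]
    exact Submodule.zero_mem _
  · exact absurd (Submodule.map_le_iff_le_comap.2 (inf_eq_left.1 h1)) hK.not_ge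

theorem mul_mem_rightSocle (c : R) {a : R} (ha : a ∈ rightSocle R) : c * a ∈ rightSocle R := by
  have key : rightSocle R ≤ (rightSocle R).comap (DistribSMul.toLinearMap Rᵐᵒᵖ R c) := by
    refine sSup_le fun I hI => ?_
    rw [← Submodule.map_le_iff_le_comap]
    rcases map_atom c hI with h | h
    · rw [h]; exact bot_le
    · exact le_sSup h
  exact key ha

variable (R) in
/-- The socle of `R`: the sum of the minimal right ideals, as a two-sided ideal. -/
def socle : TwoSidedIdeal R :=
  TwoSidedIdeal.mk' (rightSocle R : Set R)
    (rightSocle R).zero_mem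
    (fun ha hb => (rightSocle R).add_mem ha hb)
    (fun ha => (rightSocle R).neg_mem ha)
    (fun {c _} ha => mul_mem_rightSocle c ha)
    (fun {_ c} ha => (rightSocle R).smul_mem (MulOpposite.op c) ha)

variable (R) in
/-- The canonical homomorphism `π : R → R / soc(R)`. -/
def toQuot : R →+* (socle R).ringCon.Quotient := (socle R).ringCon.mk'

/-- `a` is Fredholm if it is invertible modulo the socle. -/
def IsFredholm (a : R) : Prop := IsUnit (toQuot R a)

/-- `a` is B-Fredholm if it is Drazin invertible modulo the socle. -/
def IsBFredholm (a : R) : Prop := IsDrazinInvertible (toQuot R a)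

end Ring

end BFredholm

/-! In a semiprime ring every element of the socle is von Neumann regular. Hence, if `x` is Drazin
invertible modulo the socle, all high powers of `x` are regular, so multiplication by them has
closed range, and `R(x) ∩ x^m A` is generated by an idempotent of the socle. Chain conditions make
this ideal constant for large `m`, say equal to `eA` (`IsBFredholm.exists_stable`).

Let `F` be the intersection of the ideals `x^m A`, a closed subspace. Multiplication by `x` maps `F`
onto itself with kernel `eA`, so it is invertible from `G = F ∩ R(e)` onto `F`. Eigenvectors for
small `z ≠ 0` lie in `F`, and a Neumann series on `G` shows that multiplication by `e` maps `R(x -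
z)` bijectively onto `eA` (`exists_forall_bijOn_ker_sub_smul`). This is a map of right modules, so
the orders agree (`order_eq_of_bijOn`); it also maps `R(x)` onto `eA`, whence the inequality. The
defect is the mirror image, except for the stabilization of the left ideals. That `x - z` is
Fredholm is algebra in the quotient (`isUnit_sub_of_drazin`). -/

namespace BFredholm

/-! ### Orders of submodules under linear maps -/

/-- If `J'` is a linear image of `J`, then the order of `J'` is at most that of `J`. -/
theorem order_le_of_range_eq {S M : Type*} [Ring S] [AddCommGroup M] [Module S M]
    {J J' : Submodule S M} (f : J →ₗ[S] M) (hf : LinearMap.range f = J') :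
    order J' ≤ order J := by
  classical
  refine le_iInf₂ fun s hs => ?_
  obtain ⟨hs, hsup⟩ := hs
  let g : Submodule S M → Submodule S M := fun I => (I.comap J.subtype).map f
  have hcomap : s.sup (fun I => I.comap J.subtype) = ⊤ := by
    apply Submodule.map_injective_of_injective J.injective_subtype
    rw [Finset.sup_eq_iSup, Submodule.map_iSup, Submodule.map_subtype_top]
    simp_rw [Submodule.map_iSup, Submodule.map_comap_subtype]
    rw [← hsup, Finset.sup_eq_iSup]
    refine iSup_congr fun I => iSup_congr fun hI => ?_
    rw [← Finset.sup_eq_iSup]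
    exact inf_eq_right.2 (Finset.le_sup (f := id) hI)
  have hg : ∀ I ∈ s, g I = ⊥ ∨ IsAtom (g I) := by
    intro I hI
    by_cases h : g I = ⊥
    · exact Or.inl h
    refine Or.inr ⟨h, fun K hK => ?_⟩
    have hle : ((I.comap J.subtype) ⊓ K.comap f).map J.subtype ≤ I := by
      rintro _ ⟨y, hy, rfl⟩
      exact hy.1
    rcases (hs I hI).le_iff.1 hle with h0 | h1
    · rw [eq_bot_iff]
      intro y hy
      obtain ⟨z, hz, rfl⟩ := hK.le hy
      have hz0 : (z : M) ∈ ((I.comap J.subtype) ⊓ K.comap f).map J.subtype :=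
        ⟨z, ⟨hz, hy⟩, rfl⟩
      rw [h0, Submodule.mem_bot, Submodule.coe_eq_zero] at hz0
      rw [hz0, map_zero]
      exact Submodule.zero_mem _
    · refine absurd ?_ hK.not_ge
      rintro _ ⟨z, hz, rfl⟩
      have hz' : (z : M) ∈ ((I.comap J.subtype) ⊓ K.comap f).map J.subtype := by
        rw [h1]; exact hz
      obtain ⟨w, hw, hwz⟩ := hz'
      rw [← Subtype.ext hwz]
      exact hw.2
  -- Vanishing images are not atoms; erasing `⊥` leaves the sum unchanged and cannot raise the
  -- cardinality.
  refine (iInf₂_le ((s.image g).erase ⊥) ⟨?_, ?_⟩).trans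
    (by exact_mod_cast (Finset.card_erase_le).trans Finset.card_image_le)
  · intro I hI
    obtain ⟨hne, hI⟩ := Finset.mem_erase.1 hI
    obtain ⟨I', hI', rfl⟩ := Finset.mem_image.1 hI
    exact (hg I' hI').resolve_left hne
  · rw [Finset.sup_erase_bot, Finset.sup_image, ← hf, LinearMap.range_eq_map, ← hcomap,
      Finset.sup_eq_iSup, Finset.sup_eq_iSup]
    simp_rw [Submodule.map_iSup]
    rfl

/-- If a linear map restricts to a bijection from `J` onto `J'`, the two orders agree. -/
theorem order_eq_of_bijOn {S M : Type*} [Ring S] [AddCommGroup M] [Module S M]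
    {J J' : Submodule S M} (f : M →ₗ[S] M) (hf : Set.BijOn f J J') : order J = order J' := by
  let e : J ≃ₗ[S] J' := LinearEquiv.ofBijective (f.restrict hf.mapsTo) hf.bijective
  refine le_antisymm (order_le_of_range_eq (J.subtype ∘ₗ e.symm.toLinearMap) ?_)
    (order_le_of_range_eq (J := J) (J'.subtype ∘ₗ e.toLinearMap) ?_)
  · rw [LinearMap.range_comp, LinearEquiv.range, Submodule.map_subtype_top]
  · rw [LinearMap.range_comp, LinearEquiv.range, Submodule.map_subtype_top]

/-! ### Minimal right ideals and the socle of a semiprime ring -/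

variable {R : Type*} [Ring R]

/-- The left annihilator `U` of `RaR` meets its own right annihilator in a two-sided ideal of square
zero, and `a` lies in it when `aRa = 0`. -/
theorem IsSemiprimeRing.eq_zero (hR : IsSemiprimeRing R) {a : R} (ha : ∀ r, a * r * a = 0) :
    a = 0 := by
  let U : Set R := {u | ∀ r, u * r * a = 0}
  let J : TwoSidedIdeal R := TwoSidedIdeal.mk' {v | v ∈ U ∧ ∀ u ∈ U, u * v = 0}
    ⟨fun r => by simp, fun u _ => mul_zero u⟩
    (fun {v w} hv hw => ⟨fun r => by rw [add_mul, add_mul, hv.1 r, hw.1 r, add_zero],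
      fun u hu => by rw [mul_add, hv.2 u hu, hw.2 u hu, add_zero]⟩)
    (fun {v} hv => ⟨fun r => by rw [neg_mul, neg_mul, hv.1 r, neg_zero],
      fun u hu => by rw [mul_neg, hv.2 u hu, neg_zero]⟩)
    (fun {c v} hv => ⟨fun r => by rw [mul_assoc c, mul_assoc c, hv.1 r, mul_zero],
      fun u hu => by
        rw [← mul_assoc]
        exact hv.2 _ fun r => by rw [mul_assoc u, hu]⟩)
    (fun {v c} hv => ⟨fun r => by rw [mul_assoc v, hv.1],
      fun u hu => by rw [← mul_assoc, hv.2 u hu, zero_mul]⟩)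
  have hJ : J = ⊥ := by
    refine hR J fun v hv w hw => ?_
    rw [TwoSidedIdeal.mem_mk'] at hv hw
    exact hw.2 v hv.1
  have haJ : a ∈ J := by
    rw [TwoSidedIdeal.mem_mk']
    exact ⟨ha, fun u hu => by simpa using hu 1⟩
  rw [hJ] at haJ
  exact (TwoSidedIdeal.mem_bot R).1 haJ

theorem mul_mem_right {I : Submodule Rᵐᵒᵖ R} {a : R} (ha : a ∈ I) (r : R) : a * r ∈ I :=
  I.smul_mem (MulOpposite.op r) ha

theorem rightMul_le {I : Submodule Rᵐᵒᵖ R} {a : R} (ha : a ∈ I) : rightMul a ≤ I := by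
  rintro _ ⟨r, rfl⟩
  exact mul_mem_right ha r

theorem self_mem_rightMul (a : R) : a ∈ rightMul a := ⟨1, mul_one a⟩

/-- Brauer's lemma: a minimal right ideal of a semiprime ring is generated by an idempotent. -/
theorem IsSemiprimeRing.exists_idempotent_of_isAtom (hR : IsSemiprimeRing R)
    {I : Submodule Rᵐᵒᵖ R} (hI : IsAtom I) : ∃ e, IsIdempotentElem e ∧ I = rightMul e := by
  obtain ⟨a, haI, ha⟩ := (Submodule.ne_bot_iff I).1 hI.1
  obtain ⟨r, hr⟩ : ∃ r, a * r * a ≠ 0 := by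
    by_contra! h
    exact ha (hR.eq_zero h)
  -- Since `b * a ≠ 0`, minimality makes left multiplication by `b` a bijection of `I`. The preimage
  -- `e` of `b` is idempotent because `b` kills `e * e - e`.
  set b := a * r
  have hbI : b ∈ I := mul_mem_right haI r
  have hker : I ⊓ rightAnn b = ⊥ := by
    refine (hI.le_iff.1 inf_le_left).resolve_right fun h => hr ?_
    exact ((inf_eq_left.1 h) haI : a ∈ rightAnn b)
  have hmap : I.map (DistribSMul.toLinearMap Rᵐᵒᵖ R b) = I := by
    refine (hI.le_iff.1 ?_).resolve_left fun h => hr ?_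
    · rintro _ ⟨y, -, rfl⟩
      exact mul_mem_right hbI y
    · exact (Submodule.eq_bot_iff _).1 h _ ⟨a, haI, rfl⟩
  have hb' := hbI
  rw [← hmap] at hb'
  obtain ⟨e, heI, he⟩ := hb'
  replace he : b * e = b := he
  have he0 : e ≠ 0 := by
    rintro rfl
    rw [mul_zero] at he
    exact hr (by rw [← he, zero_mul])
  refine ⟨e, ?_, ?_⟩
  · have : e * e - e ∈ I ⊓ rightAnn b :=
      ⟨I.sub_mem (mul_mem_right heI e) heI, by
        change b * (e * e - e) = 0
        rw [mul_sub, ← mul_assoc, he, he, sub_self]⟩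
    rw [hker, Submodule.mem_bot, sub_eq_zero] at this
    exact this
  · refine ((hI.le_iff.1 (rightMul_le heI)).resolve_left fun h => he0 ?_).symm
    exact (Submodule.eq_bot_iff _).1 h _ (self_mem_rightMul e)

/-- In a semiprime ring a finite sum of minimal right ideals is generated by an idempotent. -/
theorem IsSemiprimeRing.exists_idempotent_of_sup (hR : IsSemiprimeRing R)
    (s : Finset (Submodule Rᵐᵒᵖ R)) (hs : ∀ I ∈ s, IsAtom I) :
    ∃ e, IsIdempotentElem e ∧ s.sup id = rightMul e := by
  classical
  induction s using Finset.induction_on with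
  | empty =>
    refine ⟨0, mul_zero 0, ?_⟩
    rw [Finset.sup_empty, eq_comm, eq_bot_iff]
    exact rightMul_le (Submodule.zero_mem _)
  | insert I s _ ih =>
    obtain ⟨h, hh, hsup⟩ := ih fun I hI => hs I (Finset.mem_insert_of_mem hI)
    rw [Finset.sup_insert, hsup, id]
    -- `(1 - h)I` replaces `I`: it has the same sum with `hR`, and its generator `e` satisfies `h *
    -- e = 0`, so that `h + e * (1 - h)` fixes both `h` and `e`.
    set I' := I.map (DistribSMul.toLinearMap Rᵐᵒᵖ R (1 - h)) with hI'
    have hmem : ∀ y ∈ I, y - h * y ∈ I' := fun y hy =>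
      ⟨y, hy, by change (1 - h) * y = _; rw [sub_mul, one_mul]⟩
    obtain ⟨e, he, heI⟩ : ∃ e, IsIdempotentElem e ∧ I' = rightMul e := by
      rcases map_atom (1 - h) (hs I (Finset.mem_insert_self I s)) with h0 | h1
      · refine ⟨0, mul_zero 0, ?_⟩
        rw [hI', h0, eq_comm, eq_bot_iff]
        exact rightMul_le (Submodule.zero_mem _)
      · exact hR.exists_idempotent_of_isAtom h1
    have heI' : e ∈ I' := heI ▸ self_mem_rightMul e
    obtain ⟨w, hwI, hw⟩ := heI'
    replace hw : (1 - h) * w = e := hw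
    have hhe : h * e = 0 := by
      rw [← hw, ← mul_assoc, mul_sub, mul_one, hh, sub_self, zero_mul]
    have hpe : (h + e * (1 - h)) * e = e := by
      rw [add_mul, hhe, mul_assoc, sub_mul, one_mul, hhe, sub_zero, he, zero_add]
    have hph : (h + e * (1 - h)) * h = h := by
      rw [add_mul, hh, mul_assoc, sub_mul, one_mul, hh, sub_self, mul_zero, add_zero]
    have hfix : ∀ y ∈ I ⊔ rightMul h, (h + e * (1 - h)) * y = y := by
      intro y hy
      obtain ⟨u, hu, _, ⟨r, rfl⟩, rfl⟩ := Submodule.mem_sup.1 hy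
      have h1 := hmem u hu
      rw [heI] at h1
      obtain ⟨t, ht⟩ := h1
      have hu' : u = h * u + e * t := by rw [ht]; abel
      rw [hu', mul_add, mul_add, ← mul_assoc, ← mul_assoc, ← mul_assoc, hph, hpe]
    have hmem' : h + e * (1 - h) ∈ I ⊔ rightMul h := by
      have hhm : h ∈ I ⊔ rightMul h := (le_sup_right : rightMul h ≤ _) (self_mem_rightMul h)
      refine Submodule.add_mem _ hhm (mul_mem_right ?_ _)
      rw [← hw, sub_mul, one_mul]
      exact Submodule.sub_mem _ ((le_sup_left : I ≤ _) hwI) (mul_mem_right hhm w)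
    refine ⟨h + e * (1 - h), hfix _ hmem', le_antisymm ?_ (rightMul_le hmem')⟩
    intro y hy
    exact ⟨y, hfix y hy⟩

theorem mem_socle {a : R} : a ∈ socle R ↔ a ∈ rightSocle R := TwoSidedIdeal.mem_mk' ..

theorem exists_finset_of_mem_rightSocle {a : R} (ha : a ∈ rightSocle R) :
    ∃ s : Finset (Submodule Rᵐᵒᵖ R), (∀ I ∈ s, IsAtom I) ∧ a ∈ s.sup id := by
  obtain ⟨s, hs, hsm⟩ := Submodule.mem_sSup_iff_exists_finset.1 ha
  refine ⟨s, fun I hI => hs hI, ?_⟩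
  rw [Finset.sup_eq_iSup]
  exact hsm

/-- The socle of a semiprime ring is von Neumann regular. -/
theorem IsSemiprimeRing.exists_mul_mul_eq (hR : IsSemiprimeRing R) {a : R} (ha : a ∈ socle R) :
    ∃ y, a * y * a = a := by
  obtain ⟨s, hs, has⟩ := exists_finset_of_mem_rightSocle (mem_socle.1 ha)
  obtain ⟨h, hh, hsup⟩ := hR.exists_idempotent_of_sup s hs
  have hsemi : IsSemisimpleModule Rᵐᵒᵖ (rightMul h) := by
    have hsimple : ∀ I ∈ (s : Set (Submodule Rᵐᵒᵖ R)),
        IsSemisimpleModule Rᵐᵒᵖ (id I : Submodule Rᵐᵒᵖ R) := fun I hI => by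
      have : IsSimpleModule Rᵐᵒᵖ I := isSimpleModule_iff_isAtom.2 (hs I hI)
      change IsSemisimpleModule Rᵐᵒᵖ I
      infer_instance
    rw [← hsup, Finset.sup_eq_iSup]
    exact isSemisimpleModule_biSup_of_isSemisimpleModule_submodule hsimple
  rw [hsup] at has
  have hha : h * a = a := by
    obtain ⟨t, rfl⟩ := has
    rw [← mul_assoc, hh]
  -- Split `h = a * r + c` along a complement `C` of `aR` in `hR`. Then `c * a = a - a * r * a` lies
  -- in `aR ∩ C = 0`.
  obtain ⟨C, hC⟩ := exists_isCompl ((rightMul a).comap (rightMul h).subtype)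
  obtain ⟨u, ⟨r, hr⟩, c, hc, huc⟩ := Submodule.mem_sup.1
    (hC.sup_eq_top ▸ Submodule.mem_top : (⟨h, self_mem_rightMul h⟩ : rightMul h) ∈ _ ⊔ C)
  replace hr : a * r = u := hr
  replace huc : (u : R) + c = h := congrArg Subtype.val huc
  have hca : (c : R) * a = a - a * r * a := by
    rw [hr, eq_sub_iff_add_eq', ← add_mul, huc, hha]
  have hmem : MulOpposite.op a • c ∈ ((rightMul a).comap (rightMul h).subtype) ⊓ C := by
    refine ⟨⟨1 - r * a, ?_⟩, C.smul_mem _ hc⟩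
    change a * (1 - r * a) = c * a
    rw [hca, mul_sub, mul_one, mul_assoc]
  rw [hC.inf_eq_bot, Submodule.mem_bot] at hmem
  have h0 : (c : R) * a = 0 := congrArg Subtype.val hmem
  rw [hca, sub_eq_zero] at h0
  exact ⟨r, h0.symm⟩

/-- `aR` sits inside a finite sum of simple modules. The Artinian half stabilizes right ideals, the
Noetherian half left ideals, through their annihilators. -/
theorem isNoetherian_and_isArtinian_rightMul {a : R} (ha : a ∈ socle R) :
    IsNoetherian Rᵐᵒᵖ (rightMul a) ∧ IsArtinian Rᵐᵒᵖ (rightMul a) := by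
  obtain ⟨s, hs, has⟩ := exists_finset_of_mem_rightSocle (mem_socle.1 ha)
  have hle := rightMul_le has
  have hsimple : ∀ i : s, IsSimpleModule Rᵐᵒᵖ i.1 := fun i => isSimpleModule_iff_isAtom.2 (hs _ i.2)
  rw [Finset.sup_eq_iSup, iSup_subtype'] at hle
  simp only [id] at hle
  have hN : IsNoetherian Rᵐᵒᵖ (⨆ i : s, i.1 : Submodule Rᵐᵒᵖ R) := isNoetherian_iSup
  have hA : IsArtinian Rᵐᵒᵖ (⨆ i : s, i.1 : Submodule Rᵐᵒᵖ R) := isArtinian_iSup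
  exact ⟨isNoetherian_of_le hle, isArtinian_of_le hle⟩

/-! ### Punctured neighbourhood theorem for operators -/

section Banach

open Filter Topology

variable {𝕜 E : Type*} [NontriviallyNormedField 𝕜] [NormedAddCommGroup E] [NormedSpace 𝕜 E]

/-- If the kernel of `T` meets the ranges of all high powers of `T` in the same subspace, then `T`
maps the intersection of these ranges onto itself. -/
theorem exists_apply_eq_of_forall_mem_range {T : E →L[𝕜] E} {N : ℕ}
    (hstab : ∀ m, N ≤ m → ∀ v, T v = 0 → (∃ w, (T ^ N) w = v) → ∃ w, (T ^ m) w = v)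
    {y : E} (hy : ∀ m, N ≤ m → ∃ w, (T ^ m) w = y) :
    ∃ c, (∀ m, N ≤ m → ∃ w, (T ^ m) w = c) ∧ T c = y := by
  have hc : ∀ m, N ≤ m → ∃ w, T ((T ^ m) w) = y := fun m hm => by
    obtain ⟨w, hw⟩ := hy (m + 1) (by omega)
    exact ⟨w, by rw [← hw, pow_succ']; rfl⟩
  obtain ⟨w₀, hw₀⟩ := hc N le_rfl
  refine ⟨(T ^ N) w₀, fun m hm => ?_, hw₀⟩
  obtain ⟨w, hw⟩ := hc m hm
  -- Two preimages of `y` differ by a kernel vector in the range of `T ^ N`, hence in that of `T ^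
  -- m`; so the preimage chosen for `N` lies in every range.
  obtain ⟨w', hw'⟩ := hstab m hm ((T ^ N) w₀ - (T ^ m) w) (by rw [map_sub, hw₀, hw, sub_self])
    ⟨w₀ - (T ^ (m - N)) w, by
      rw [map_sub, ← mul_apply_eq_comp, ← pow_add, Nat.add_sub_cancel' hm]⟩
  exact ⟨w' + w, by rw [map_add, hw', sub_add_cancel]⟩

/-- Punctured neighbourhood theorem: let the ranges of the high powers of `T` be closed and let all
of them meet the kernel of `T` in the range of the same bounded projection `P`. Then `P` maps the
kernel of `T - z` bijectively onto its range, for all small `z ≠ 0`. -/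
theorem exists_forall_bijOn_ker_sub_smul [CompleteSpace E] {T P : E →L[𝕜] E} {N : ℕ}
    (hclosed : ∀ m, N ≤ m → IsClosed (Set.range (T ^ m)))
    (hP : ∀ v, P (P v) = P v)
    (hker : ∀ m, N ≤ m → ∀ v, P v = v ↔ T v = 0 ∧ ∃ w, (T ^ m) w = v) :
    ∃ ε : ℝ, 0 < ε ∧ ∀ z : 𝕜, 0 < ‖z‖ → ‖z‖ < ε →
      Set.BijOn P {v | T v = z • v} {v | P v = v} := by
  let F : Submodule 𝕜 E :=
    { carrier := {v | ∀ m, N ≤ m → ∃ w, (T ^ m) w = v}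
      add_mem' := fun {a b} ha hb m hm => by
        obtain ⟨u, rfl⟩ := ha m hm
        obtain ⟨v, rfl⟩ := hb m hm
        exact ⟨u + v, map_add _ _ _⟩
      zero_mem' := fun m _ => ⟨0, map_zero _⟩
      smul_mem' := fun c a ha m hm => by
        obtain ⟨u, rfl⟩ := ha m hm
        exact ⟨c • u, map_smul _ _ _⟩ }
  have hF : IsClosed (F : Set E) := by
    have : (F : Set E) = ⋂ m, ⋂ (_ : N ≤ m), Set.range (T ^ m) := by
      ext v
      simp only [Set.mem_iInter, Set.mem_range]
      rfl
    rw [this]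
    exact isClosed_iInter fun m => isClosed_iInter fun hm => hclosed m hm
  have hPF : ∀ v, P v = v → v ∈ F := fun v hv m hm => ((hker m hm v).1 hv).2
  have hTP : ∀ v, P v = v → T v = 0 := fun v hv => ((hker N le_rfl v).1 hv).1
  have hTF : ∀ v ∈ F, T v ∈ F := fun v hv m hm => by
    obtain ⟨w, rfl⟩ := hv m hm
    exact ⟨T w, by rw [← mul_apply_eq_comp, ← mul_apply_eq_comp,
      ← pow_succ, ← pow_succ']⟩
  -- `G` is the complement in `F` of the range of `P`, which is the kernel of `T` on `F`.
  let G : Submodule 𝕜 E := F ⊓ LinearMap.ker (P : E →ₗ[𝕜] E)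
  have hG : IsClosed (G : Set E) := hF.inter P.isClosed_ker
  have : CompleteSpace F := hF.completeSpace_coe
  have : CompleteSpace G := hG.completeSpace_coe
  let T' : G →L[𝕜] F := (T.comp G.subtypeL).codRestrict F fun g => hTF g g.2.1
  have hinj : LinearMap.ker (T' : G →ₗ[𝕜] F) = ⊥ := by
    rw [LinearMap.ker_eq_bot']
    intro g hg
    have hg' : T g = 0 := congrArg Subtype.val hg
    have : P g = g := (hker N le_rfl g).2 ⟨hg', g.2.1 N le_rfl⟩
    rw [show P g = 0 from g.2.2] at this
    exact Subtype.ext this.symm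
  have hsurj : LinearMap.range (T' : G →ₗ[𝕜] F) = ⊤ := by
    rw [LinearMap.range_eq_top]
    rintro ⟨y, hy⟩
    obtain ⟨c, hc, rfl⟩ := exists_apply_eq_of_forall_mem_range
      (fun m hm v hv hw => ((hker m hm v).1 ((hker N le_rfl v).2 ⟨hv, hw⟩)).2) hy
    refine ⟨⟨c - P c, F.sub_mem hc (hPF _ (hP c)), ?_⟩, Subtype.ext ?_⟩
    · change P (c - P c) = 0
      rw [map_sub, hP, sub_self]
    · change T (c - P c) = T c
      rw [map_sub, hTP _ (hP c), sub_zero]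
  let e : G ≃L[𝕜] F := ContinuousLinearEquiv.ofBijective T' hinj hsurj
  have he : ∀ g : G, (e g : E) = T g := fun g => rfl
  -- The inverse of `T : G → F`, restricted to `G`; `1 - z • S` is invertible once `‖z‖ * ‖S‖ < 1`.
  let S : G →L[𝕜] G := (e.symm : F →L[𝕜] G).comp
    (G.subtypeL.codRestrict F fun g => g.2.1)
  have hS : ∀ g : G, T (S g) = g := fun g => by
    rw [← he]
    exact congrArg Subtype.val (e.apply_symm_apply _)
  refine ⟨(‖S‖ + 1)⁻¹, by positivity, fun z hz hzε => ?_⟩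
  have hz0 : z ≠ 0 := norm_pos_iff.1 hz
  have hunit : IsUnit (1 - z • S) := by
    refine isUnit_one_sub_of_norm_lt_one ?_
    rw [norm_smul]
    calc ‖z‖ * ‖S‖ ≤ ‖z‖ * (‖S‖ + 1) := by gcongr; linarith
      _ < 1 := by rwa [← lt_div_iff₀ (by positivity), one_div]
  obtain ⟨U, hU⟩ := hunit
  have hUinj : ∀ g : G, g - z • S g = 0 → g = 0 := fun g hg => by
    have h1 : (U : G →L[𝕜] G) g = 0 := by rw [hU]; exact hg
    have h2 : ((↑U⁻¹ * ↑U : G →L[𝕜] G)) g = 0 := by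
      rw [mul_apply_eq_comp, h1, map_zero]
    rwa [Units.inv_mul] at h2
  have hFmem : ∀ v, T v = z • v → v ∈ F := fun v hv m _ => by
    have hpow : ∀ m : ℕ, (T ^ m) v = z ^ m • v := fun m => by
      induction m with
      | zero => simp
      | succ m ih => rw [pow_succ, mul_apply_eq_comp, hv, map_smul, ih, smul_smul,
          pow_succ']
    exact ⟨(z ^ m)⁻¹ • v, by rw [map_smul, hpow, inv_smul_smul₀ (pow_ne_zero m hz0)]⟩
  refine ⟨fun v _ => hP v, fun v hv w hw hvw => ?_, fun w hw => ?_⟩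
  · have hvw' : T (v - w) = z • (v - w) := by
      rw [map_sub, hv, hw, smul_sub]
    let g : G := ⟨v - w, hFmem _ hvw', by
      change P (v - w) = 0
      rw [map_sub, hvw, sub_self]⟩
    have hg : e g = e (z • S g) := Subtype.ext (by
      rw [he, he]
      change T (v - w) = T (z • (S g : E))
      rw [map_smul, hS, hvw'])
    have h0 := hUinj g (sub_eq_zero.2 (e.injective hg))
    exact sub_eq_zero.1 (congrArg Subtype.val h0)
  · replace hw : P w = w := hw
    let s : G := e.symm ⟨w, hPF w hw⟩
    have hs : T s = w := by
      rw [← he]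
      exact congrArg Subtype.val (e.apply_symm_apply _)
    -- Since `T w = 0`, the equation `T (w + g) = z • (w + g)` amounts to `g - z • S g = z • s`.
    let g : G := (↑U⁻¹ : G →L[𝕜] G) (z • s)
    have hg : g - z • S g = z • s := by
      have : ((↑U * ↑U⁻¹ : G →L[𝕜] G)) (z • s) = z • s := by rw [Units.mul_inv]; rfl
      rw [mul_apply_eq_comp, hU] at this
      exact this
    have hg' : (g : E) = z • (S g : E) + z • (s : E) := by
      rw [← sub_eq_iff_eq_add']
      exact congrArg Subtype.val hg
    have hTg : T g = z • (g : E) + z • w := by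
      conv_lhs => rw [hg']
      rw [map_add, map_smul, map_smul, hS, hs]
    refine ⟨w + g, ?_, ?_⟩
    · change T (w + g) = z • (w + (g : E))
      rw [map_add, hTP w hw, hTg, zero_add, smul_add, add_comm]
    · rw [map_add, hw, show P g = 0 from g.2.2, add_zero]

end Banach

/-! ### Perturbation of Drazin invertible elements -/

/-- Let `b` be a Drazin inverse of `a` and let `l` be a central unit such that `1 - l b` is
invertible. Then `a - l` is invertible. -/
theorem isUnit_sub_of_drazin {Q : Type*} [Ring Q] {a b l : Q} {k : ℕ}
    (hcomm : a * b = b * a) (hk : a ^ k * b * a = a ^ k)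
    (hl : IsUnit l) (hlc : ∀ q, l * q = q * l) (hlb : IsUnit (1 - l * b)) : IsUnit (a - l) := by
  obtain ⟨l, rfl⟩ := hl
  have hla : Commute a (l : Q) := (hlc a).symm
  have hab : Commute a b := hcomm
  have hlb' : Commute b (l : Q) := (hlc b).symm
  have hli : Commute a (↑(l ^ k)⁻¹ : Q) := (Units.val_pow_eq_pow_val l k ▸ hla.pow_right k :
    Commute a ((l ^ k : Qˣ) : Q)).units_inv_right
  have hlib : Commute (l : Q) (↑(l ^ k)⁻¹ : Q) := hlc _
  set q := ∑ i ∈ Finset.range k, a ^ i * (l : Q) ^ (k - 1 - i) with hq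
  have hgeom : (a - l) * q = a ^ k - (l : Q) ^ k := hla.mul_geom_sum₂ k
  have hqa : Commute (a - l) q := by
    refine Commute.sum_right _ _ _ fun i _ => ?_
    refine Commute.sub_left ?_ ?_
    · exact ((Commute.refl a).pow_right i).mul_right (hla.pow_right _)
    · exact (hla.symm.pow_right i).mul_right ((Commute.refl _).pow_right _)
  have hpk : a ^ k * (1 - a * b) = 0 := by
    rw [hcomm, mul_sub, mul_one, ← mul_assoc, hk, sub_self]
  have hpl : Commute (a - l) (1 - a * b) := by
    refine Commute.sub_left ?_ ?_
    · exact (Commute.one_right a).sub_right ((Commute.refl a).mul_right hab)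
    · exact hlc _
  -- As `a ^ k` kills `1 - a * b`, the geometric sum gives `(a - l) * q * (1 - a * b) = -l ^ k * (1
  -- - a * b)`. Hence `(a - l) * c = a * b - l * b + (1 - a * b)`.
  set c := b - q * (1 - a * b) * (↑(l ^ k)⁻¹ : Q) with hc
  have hprod : (a - l) * c = 1 - l * b := by
    rw [hc, mul_sub, ← mul_assoc, ← mul_assoc, hgeom, sub_mul _ _ (1 - a * b), hpk, zero_sub,
      sub_mul, neg_mul, ← Units.val_pow_eq_pow_val, (show ((l ^ k : Qˣ) : Q) * (1 - a * b) =
        (1 - a * b) * ((l ^ k : Qˣ) : Q) by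
          rw [Units.val_pow_eq_pow_val]
          exact (Commute.pow_left (hlc _ : Commute (l : Q) (1 - a * b)) k)),
      mul_assoc, Units.mul_inv]
    noncomm_ring
  have hcc : Commute (a - l) c := by
    refine Commute.sub_right ?_ ?_
    · exact hab.sub_left hlb'.symm
    · exact (hqa.mul_right hpl).mul_right (hli.sub_left hlib)
  exact (hcc.isUnit_mul_iff.1 (hprod ▸ hlb)).1

/-! ### Regularity, idempotents and stabilization modulo the socle -/

section Socle

variable {R : Type*} [Ring R]

theorem toQuot_surjective : Function.Surjective (toQuot R) := RingCon.mk'_surjective _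

theorem toQuot_eq_iff {a b : R} : toQuot R a = toQuot R b ↔ a - b ∈ socle R :=
  (RingCon.eq _).trans (TwoSidedIdeal.rel_iff _ _ _)

theorem toQuot_eq_zero_iff {a : R} : toQuot R a = 0 ↔ a ∈ socle R := by
  rw [← map_zero (toQuot R), toQuot_eq_iff, sub_zero]

/-- An element that is regular modulo the socle is regular. -/
theorem IsSemiprimeRing.exists_mul_mul_eq_of_toQuot (hR : IsSemiprimeRing R) {a b : R}
    (h : toQuot R (a * b * a) = toQuot R a) : ∃ y, a * y * a = a := by
  obtain ⟨w, hw⟩ := hR.exists_mul_mul_eq (toQuot_eq_iff.1 h)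
  -- Both `a * (1 - b * a)` and `(1 - a * b) * a` equal `a - a * b * a`, a socle element with
  -- generalized inverse `w` up to signs that cancel.
  refine ⟨b - (1 - b * a) * w * (1 - a * b), ?_⟩
  have h1 : a * (b - (1 - b * a) * w * (1 - a * b)) * a =
      a * b * a - (a * b * a - a) * w * (a * b * a - a) := by noncomm_ring
  rw [h1, hw, sub_sub_cancel]

theorem pow_eq_mul_pow_succ {Q : Type*} [Ring Q] {q b : Q} {k : ℕ} (hcomm : q * b = b * q)
    (hk : q ^ k * b * q = q ^ k) {m : ℕ} (hm : k ≤ m) : b * q ^ (m + 1) = q ^ m := by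
  obtain ⟨i, rfl⟩ := Nat.exists_eq_add_of_le hm
  have hc : Commute b (q ^ k) := (Commute.pow_left (hcomm : Commute q b) k).symm
  calc b * q ^ (k + i + 1) = b * q ^ k * q * q ^ i := by
        rw [mul_assoc, mul_assoc, ← pow_succ', ← pow_add, add_assoc]
    _ = q ^ (k + i) := by rw [hc.eq, hk, ← pow_add]

/-- Each factor `b` removes one factor `q` from powers past the index, so `b ^ m` lowers the
exponent `m + m` to `m`. -/
theorem pow_mul_pow_mul_pow {Q : Type*} [Ring Q] {q b : Q} {k : ℕ} (hcomm : q * b = b * q)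
    (hk : q ^ k * b * q = q ^ k) {m : ℕ} (hm : k ≤ m) : q ^ m * b ^ m * q ^ m = q ^ m := by
  have key : ∀ j, b ^ j * q ^ (m + j) = q ^ m := fun j => by
    induction j with
    | zero => simp
    | succ j ih =>
      rw [pow_succ, mul_assoc, ← add_assoc, pow_eq_mul_pow_succ hcomm hk (by omega), ih]
  rw [(show Commute q b from hcomm).pow_pow m m, mul_assoc, ← pow_add, key]

/-- If `x ^ m` and `x ^ (m + 1)` behave as for a Drazin invertible element modulo the socle, then
`R(x) ∩ x ^ m R` is generated by an idempotent of the socle. -/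
theorem IsSemiprimeRing.exists_idempotent_right (hR : IsSemiprimeRing R) {x y : R} {m : ℕ}
    {b : (socle R).ringCon.Quotient} (hb : b * toQuot R x ^ (m + 1) = toQuot R x ^ m)
    (hy : x ^ (m + 1) * y * x ^ (m + 1) = x ^ (m + 1)) :
    ∃ e ∈ socle R, IsIdempotentElem e ∧ ∀ a, e * a = a ↔ x * a = 0 ∧ ∃ c, x ^ m * c = a := by
  -- `1 - y * x ^ (m + 1)` projects onto the annihilator of `x ^ (m + 1)`, so `tR = R(x) ∩ x ^ m R`.
  -- Modulo the socle `t` equals `b * x * t = 0`.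
  set t := x ^ m * (1 - y * x ^ (m + 1)) with ht
  have hxt : x * t = 0 := by
    rw [ht, ← mul_assoc, ← pow_succ', mul_sub, mul_one, ← mul_assoc, hy, sub_self]
  have hts : t ∈ socle R := by
    have h1 : toQuot R t = b * toQuot R (x * t) := by
      rw [ht, map_mul, map_mul, map_mul, map_pow, ← mul_assoc, ← mul_assoc, mul_assoc b,
        ← pow_succ', hb]
    rw [← toQuot_eq_zero_iff, h1, hxt, map_zero, mul_zero]
  obtain ⟨w, hw⟩ := hR.exists_mul_mul_eq hts
  refine ⟨t * w, (socle R).mul_mem_right _ _ hts, ?_, fun a => ⟨fun ha => ⟨?_, ?_⟩, ?_⟩⟩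
  · rw [IsIdempotentElem, ← mul_assoc, hw]
  · rw [← ha, ← mul_assoc, ← mul_assoc, hxt, zero_mul, zero_mul]
  · exact ⟨(1 - y * x ^ (m + 1)) * (w * a), by rw [← mul_assoc, ← ht, ← mul_assoc, ha]⟩
  · rintro ⟨hxa, c, rfl⟩
    rw [← mul_assoc, ← pow_succ'] at hxa
    have hc : x ^ m * c = t * c := by
      rw [ht, mul_sub, mul_one, sub_mul, mul_assoc, mul_assoc, hxa, mul_zero, mul_zero, sub_zero]
    rw [hc, ← mul_assoc, hw]

/-- If `x ^ m` and `x ^ (m + 1)` behave as for a Drazin invertible element modulo the socle, then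
`L(x) ∩ R x ^ m` is generated by an idempotent of the socle. -/
theorem IsSemiprimeRing.exists_idempotent_left (hR : IsSemiprimeRing R) {x y : R} {m : ℕ}
    {b : (socle R).ringCon.Quotient} (hb : toQuot R x ^ (m + 1) * b = toQuot R x ^ m)
    (hy : x ^ (m + 1) * y * x ^ (m + 1) = x ^ (m + 1)) :
    ∃ e ∈ socle R, IsIdempotentElem e ∧ ∀ a, a * e = a ↔ a * x = 0 ∧ ∃ c, c * x ^ m = a := by
  set t := (1 - x ^ (m + 1) * y) * x ^ m with ht
  have hxt : t * x = 0 := by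
    rw [ht, mul_assoc, ← pow_succ, sub_mul, one_mul, hy, sub_self]
  have hts : t ∈ socle R := by
    have h1 : toQuot R t = toQuot R (t * x) * b := by
      rw [ht, map_mul, map_mul, map_mul, map_pow, mul_assoc, mul_assoc, ← mul_assoc _ _ b,
        ← pow_succ, hb]
    rw [← toQuot_eq_zero_iff, h1, hxt, map_zero, zero_mul]
  obtain ⟨w, hw⟩ := hR.exists_mul_mul_eq hts
  refine ⟨w * t, (socle R).mul_mem_left _ _ hts, ?_, fun a => ⟨fun ha => ⟨?_, ?_⟩, ?_⟩⟩
  · rw [IsIdempotentElem, mul_assoc, ← mul_assoc t, hw]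
  · rw [← ha, mul_assoc, mul_assoc, hxt, mul_zero, mul_zero]
  · exact ⟨a * w * (1 - x ^ (m + 1) * y), by rw [mul_assoc, ← ht, mul_assoc, ha]⟩
  · rintro ⟨hxa, c, rfl⟩
    rw [mul_assoc, ← pow_succ] at hxa
    have hc : c * x ^ m = c * t := by
      rw [ht, sub_mul, one_mul, mul_sub, ← mul_assoc, ← mul_assoc, hxa, zero_mul, zero_mul,
        sub_zero]
    rw [hc, mul_assoc, ← mul_assoc t, hw]

/-- For a descending sequence of right ideals `e i R`, `e i` in the socle, the sequence
stabilizes. -/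
theorem exists_stable_right {e : ℕ → R} (he : e 0 ∈ socle R)
    (hdesc : ∀ i j, i ≤ j → ∀ a, e j * a = a → e i * a = a) :
    ∃ n, ∀ i, n ≤ i → ∀ a, e i * a = a ↔ e n * a = a := by
  have := (isNoetherian_and_isArtinian_rightMul he).2
  let K : ℕ → Submodule Rᵐᵒᵖ R := fun i => LinearMap.eqLocus
    (DistribSMul.toLinearMap Rᵐᵒᵖ R (e i)) LinearMap.id
  obtain ⟨n, hn⟩ := IsArtinian.monotone_stabilizes
    (⟨fun i => OrderDual.toDual ((K i).comap (rightMul (e 0)).subtype),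
      fun i j hij a ha => hdesc i j hij a ha⟩ : ℕ →o (Submodule Rᵐᵒᵖ (rightMul (e 0)))ᵒᵈ)
  refine ⟨n, fun i hi a => ⟨hdesc n i hi a, fun ha => ?_⟩⟩
  have h0 : a ∈ rightMul (e 0) := ⟨a, hdesc 0 n (Nat.zero_le n) a ha⟩
  have h1 : (⟨a, h0⟩ : rightMul (e 0)) ∈ (K n).comap (rightMul (e 0)).subtype := ha
  have h2 : (K n).comap (rightMul (e 0)).subtype = (K i).comap (rightMul (e 0)).subtype := hn i hi
  rw [h2] at h1
  exact h1

/-- For a descending sequence of left ideals `R e i`, `e i` an idempotent of the right socle, the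
sequence stabilizes. -/
theorem exists_stable_left {e : ℕ → R} (he : e 0 ∈ socle R) (hidem : ∀ i, IsIdempotentElem (e i))
    (hdesc : ∀ i j, i ≤ j → ∀ a, a * e j = a → a * e i = a) :
    ∃ n, ∀ i, n ≤ i → ∀ a, a * e i = a ↔ a * e n = a := by
  have := (isNoetherian_and_isArtinian_rightMul he).1
  -- The chain conditions at hand concern right ideals only, so the descending left ideals are
  -- traded for their ascending right annihilators inside `e 0 R`.
  obtain ⟨n, hn⟩ := monotone_stabilizes_iff_noetherian.2 this
    ⟨fun i => (rightAnn (e i)).comap (rightMul (e 0)).subtype, fun i j hij a ha => by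
      change e j * a = 0
      rw [← hdesc i j hij (e j) (hidem j), mul_assoc, show e i * (a : R) = 0 from ha, mul_zero]⟩
  refine ⟨n, fun i hi a => ⟨hdesc n i hi a, fun ha => ?_⟩⟩
  -- Since `e i * e 0 = e i`, this element is killed by `e i`, hence by `e n`; together with `e n *
  -- e 0 = e n` this yields `e n = e n * e i`.
  have h1 : (⟨e 0 * (1 - e i), 1 - e i, rfl⟩ : rightMul (e 0)) ∈
      (rightAnn (e i)).comap (rightMul (e 0)).subtype := by
    change e i * (e 0 * (1 - e i)) = 0
    rw [← mul_assoc, hdesc 0 i (Nat.zero_le i) (e i) (hidem i), mul_sub, mul_one, hidem i, sub_self]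
  have h2 : (rightAnn (e n)).comap (rightMul (e 0)).subtype =
    (rightAnn (e i)).comap (rightMul (e 0)).subtype := hn i hi
  rw [← h2] at h1
  replace h1 : e n * (e 0 * (1 - e i)) = 0 := h1
  rw [← mul_assoc, hdesc 0 n (Nat.zero_le n) (e n) (hidem n), mul_sub, mul_one, sub_eq_zero] at h1
  rw [← ha, mul_assoc, ← h1]

/-- For a B-Fredholm element `x`, all high powers are regular, and the ideals `R(x) ∩ x ^ m R` and
`L(x) ∩ R x ^ m` do not depend on `m` for large `m` and are generated by idempotents. -/
theorem IsBFredholm.exists_stable (hR : IsSemiprimeRing R) {x : R} (hx : IsBFredholm x) :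
    ∃ N, (∀ m, N ≤ m → ∃ y, x ^ m * y * x ^ m = x ^ m) ∧
      (∃ e, IsIdempotentElem e ∧ ∀ m, N ≤ m → ∀ a, e * a = a ↔ x * a = 0 ∧ ∃ c, x ^ m * c = a) ∧
      ∃ e, IsIdempotentElem e ∧ ∀ m, N ≤ m → ∀ a, a * e = a ↔ a * x = 0 ∧ ∃ c, c * x ^ m = a := by
  obtain ⟨b, -, hcomm, k, hk⟩ := hx
  obtain ⟨β, rfl⟩ := toQuot_surjective b
  have hreg : ∀ m, k ≤ m → ∃ y, x ^ m * y * x ^ m = x ^ m := fun m hm =>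
    hR.exists_mul_mul_eq_of_toQuot (b := β ^ m) (by
      simp only [map_mul, map_pow]
      exact pow_mul_pow_mul_pow hcomm hk hm)
  have hb : ∀ m, k ≤ m → toQuot R β * toQuot R x ^ (m + 1) = toQuot R x ^ m := fun m hm =>
    pow_eq_mul_pow_succ hcomm hk hm
  have hb' : ∀ m, k ≤ m → toQuot R x ^ (m + 1) * toQuot R β = toQuot R x ^ m := fun m hm => by
    rw [(show Commute _ _ from hcomm).pow_left (m + 1), hb m hm]
  have hr : ∀ i, ∃ e ∈ socle R, IsIdempotentElem e ∧
      ∀ a, e * a = a ↔ x * a = 0 ∧ ∃ c, x ^ (k + i) * c = a := fun i => by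
    obtain ⟨y, hy⟩ := hreg (k + i + 1) (by omega)
    exact hR.exists_idempotent_right (hb _ (by omega)) hy
  have hl : ∀ i, ∃ e ∈ socle R, IsIdempotentElem e ∧
      ∀ a, a * e = a ↔ a * x = 0 ∧ ∃ c, c * x ^ (k + i) = a := fun i => by
    obtain ⟨y, hy⟩ := hreg (k + i + 1) (by omega)
    exact hR.exists_idempotent_left (hb' _ (by omega)) hy
  choose e hes hei he using hr
  choose f hfs hfi hf using hl
  obtain ⟨n₁, hn₁⟩ := exists_stable_right (hes 0) fun i j hij a ha => by
    obtain ⟨hxa, c, rfl⟩ := (he j a).1 ha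
    refine (he i _).2 ⟨hxa, x ^ (j - i) * c, ?_⟩
    rw [← mul_assoc, ← pow_add, add_assoc, Nat.add_sub_cancel' hij]
  obtain ⟨n₂, hn₂⟩ := exists_stable_left (hfs 0) hfi fun i j hij a ha => by
    obtain ⟨hxa, c, rfl⟩ := (hf j a).1 ha
    refine (hf i _).2 ⟨hxa, c * x ^ (j - i), ?_⟩
    rw [mul_assoc, ← pow_add, show j - i + (k + i) = k + j by omega]
  refine ⟨k + (n₁ + n₂), fun m hm => hreg m (by omega), ⟨e n₁, hei n₁, fun m hm a => ?_⟩,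
    ⟨f n₂, hfi n₂, fun m hm a => ?_⟩⟩
  · obtain ⟨i, rfl⟩ := Nat.exists_eq_add_of_le ((Nat.le_add_right k _).trans hm)
    rw [← hn₁ i (by omega), he]
  · obtain ⟨i, rfl⟩ := Nat.exists_eq_add_of_le ((Nat.le_add_right k _).trans hm)
    rw [← hn₂ i (by omega), hf]

end Socle

/-! ### Nullity, defect and Fredholmness of small perturbations -/

section BanachAlgebra

variable {A : Type*} [NormedRing A] [NormedAlgebra ℂ A]

theorem mul_pow_apply (x : A) (m : ℕ) (a : A) :
    (ContinuousLinearMap.mul ℂ A x ^ m) a = x ^ m * a := by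
  induction m generalizing a with
  | zero => simp
  | succ m ih => rw [pow_succ, mul_apply_eq_comp, ih, pow_succ, mul_assoc]; rfl

theorem mul_flip_pow_apply (x : A) (m : ℕ) (a : A) :
    ((ContinuousLinearMap.mul ℂ A).flip x ^ m) a = a * x ^ m := by
  induction m generalizing a with
  | zero => simp
  | succ m ih => rw [pow_succ, mul_apply_eq_comp, ih, pow_succ', ← mul_assoc]; rfl

theorem mem_rightAnn_sub_algebraMap {x a : A} {z : ℂ} :
    a ∈ rightAnn (x - algebraMap ℂ A z) ↔ x * a = z • a := by
  change (x - algebraMap ℂ A z) * a = 0 ↔ _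
  rw [sub_mul, sub_eq_zero, Algebra.smul_def]

theorem mem_leftAnn_sub_algebraMap {x a : A} {z : ℂ} :
    a ∈ leftAnn (x - algebraMap ℂ A z) ↔ a * x = z • a := by
  change a * (x - algebraMap ℂ A z) = 0 ↔ _
  rw [mul_sub, sub_eq_zero, Algebra.smul_def, Algebra.commutes]

/-- The punctured neighbourhood theorem for the nullity. -/
theorem exists_nullity_sub_algebraMap [CompleteSpace A] {x e : A} {N : ℕ}
    (hreg : ∀ m, N ≤ m → ∃ y, x ^ m * y * x ^ m = x ^ m)
    (hee : IsIdempotentElem e)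
    (he : ∀ m, N ≤ m → ∀ a, e * a = a ↔ x * a = 0 ∧ ∃ c, x ^ m * c = a) :
    ∃ ε : ℝ, 0 < ε ∧ ∀ z : ℂ, 0 < ‖z‖ → ‖z‖ < ε →
      nullity (x - algebraMap ℂ A z) = order (rightAnn x ⊓ rightMul (x ^ N)) := by
  obtain ⟨ε, hε, h⟩ := exists_forall_bijOn_ker_sub_smul (T := ContinuousLinearMap.mul ℂ A x)
    (P := ContinuousLinearMap.mul ℂ A e) (N := N)
    (fun m hm => by
      obtain ⟨y, hy⟩ := hreg m hm
      -- The range is the fixed-point set of the idempotent `x ^ m * y`, hence closed.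
      have : Set.range (ContinuousLinearMap.mul ℂ A x ^ m) = {a | x ^ m * y * a = a} := by
        ext a
        simp only [Set.mem_range, mul_pow_apply, Set.mem_ofPred_eq]
        constructor
        · rintro ⟨c, rfl⟩
          rw [← mul_assoc, hy]
        · exact fun ha => ⟨y * a, by rw [← mul_assoc, ha]⟩
      rw [this]
      exact isClosed_eq (by fun_prop) continuous_id)
    (fun v => by simp only [ContinuousLinearMap.mul_apply', ← mul_assoc, hee.eq])
    (fun m hm v => by
      simp only [mul_pow_apply]
      exact he m hm v)
  refine ⟨ε, hε, fun z hz hzε => order_eq_of_bijOn (DistribSMul.toLinearMap Aᵐᵒᵖ A e) ?_⟩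
  convert h z hz hzε using 1
  · rfl
  · ext a
    exact mem_rightAnn_sub_algebraMap
  · ext a
    exact (he N le_rfl a).symm

/-- The punctured neighbourhood theorem for the defect. -/
theorem exists_defect_sub_algebraMap [CompleteSpace A] {x e : A} {N : ℕ}
    (hreg : ∀ m, N ≤ m → ∃ y, x ^ m * y * x ^ m = x ^ m)
    (hee : IsIdempotentElem e)
    (he : ∀ m, N ≤ m → ∀ a, a * e = a ↔ a * x = 0 ∧ ∃ c, c * x ^ m = a) :
    ∃ ε : ℝ, 0 < ε ∧ ∀ z : ℂ, 0 < ‖z‖ → ‖z‖ < ε →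
      defect (x - algebraMap ℂ A z) = order (leftAnn x ⊓ leftMul (x ^ N)) := by
  obtain ⟨ε, hε, h⟩ := exists_forall_bijOn_ker_sub_smul
    (T := (ContinuousLinearMap.mul ℂ A).flip x)
    (P := (ContinuousLinearMap.mul ℂ A).flip e) (N := N)
    (fun m hm => by
      obtain ⟨y, hy⟩ := hreg m hm
      have : Set.range ((ContinuousLinearMap.mul ℂ A).flip x ^ m) =
          {a | a * (y * x ^ m) = a} := by
        ext a
        simp only [Set.mem_range, mul_flip_pow_apply, Set.mem_ofPred_eq]
        constructor
        · rintro ⟨c, rfl⟩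
          rw [mul_assoc, ← mul_assoc _ y, hy]
        · exact fun ha => ⟨a * y, by rw [mul_assoc, ha]⟩
      rw [this]
      exact isClosed_eq (by fun_prop) continuous_id)
    (fun v => by simp only [ContinuousLinearMap.flip_apply, ContinuousLinearMap.mul_apply',
      mul_assoc, hee.eq])
    (fun m hm v => by
      simp only [mul_flip_pow_apply]
      exact he m hm v)
  refine ⟨ε, hε, fun z hz hzε => order_eq_of_bijOn (LinearMap.toSpanSingleton A A e) ?_⟩
  convert h z hz hzε using 1
  · rfl
  · ext a
    exact mem_leftAnn_sub_algebraMap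
  · ext a
    exact (he N le_rfl a).symm

/-- If `x` is B-Fredholm, then `x - z` is Fredholm for all small `z ≠ 0`. -/
theorem IsBFredholm.exists_isFredholm_sub_algebraMap [CompleteSpace A] {x : A}
    (hx : IsBFredholm x) : ∃ ε : ℝ, 0 < ε ∧ ∀ z : ℂ, 0 < ‖z‖ → ‖z‖ < ε →
      IsFredholm (x - algebraMap ℂ A z) := by
  obtain ⟨b, -, hcomm, k, hk⟩ := hx
  obtain ⟨β, rfl⟩ := toQuot_surjective b
  refine ⟨(‖β‖ + 1)⁻¹, by positivity, fun z hz hzε => ?_⟩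
  -- The socle need not be closed, so the Neumann series is summed in `A` for a lift `β`, and only
  -- the invertibility passes to the quotient.
  have hunit : IsUnit (1 - algebraMap ℂ A z * β) := by
    rw [← Algebra.smul_def]
    refine isUnit_one_sub_of_norm_lt_one ?_
    rw [norm_smul]
    calc ‖z‖ * ‖β‖ ≤ ‖z‖ * (‖β‖ + 1) := by gcongr; linarith
      _ < 1 := by rwa [← lt_div_iff₀ (by positivity), one_div]
  unfold IsFredholm
  rw [map_sub]
  refine isUnit_sub_of_drazin hcomm hk
    (((norm_pos_iff.1 hz).isUnit.map (algebraMap ℂ A)).map (toQuot A)) (fun q => ?_) ?_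
  · obtain ⟨r, rfl⟩ := toQuot_surjective q
    rw [← map_mul, Algebra.commutes, map_mul]
  · simpa using hunit.map (toQuot A)

end BanachAlgebra

end BFredholm

/-! ### The main theorem -/

theorem theorem2p6 {A : Type*} [NormedRing A] [NormedAlgebra ℂ A] [CompleteSpace A]
    (hA : BFredholm.IsSemiprimeRing A) (x : A) (hx : BFredholm.IsBFredholm x) :
    ∃ ε : ℝ, 0 < ε ∧ ∃ (N : ℕ) (n d : ℕ∞),
      (∀ m : ℕ, N ≤ m →
        BFredholm.order (BFredholm.rightAnn x ⊓ BFredholm.rightMul (x ^ m)) = n ∧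
        BFredholm.order (BFredholm.leftAnn x ⊓ BFredholm.leftMul (x ^ m)) = d) ∧
      n ≤ BFredholm.nullity x ∧ d ≤ BFredholm.defect x ∧
      ∀ z : ℂ, 0 < ‖z‖ → ‖z‖ < ε →
        BFredholm.IsFredholm (x - algebraMap ℂ A z) ∧
        BFredholm.nullity (x - algebraMap ℂ A z) = n ∧
        BFredholm.defect (x - algebraMap ℂ A z) = d := by
  obtain ⟨N, hreg, ⟨e, hee, he⟩, ⟨f, hff, hf⟩⟩ := hx.exists_stable hA
  obtain ⟨ε₁, hε₁, h₁⟩ := hx.exists_isFredholm_sub_algebraMap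
  obtain ⟨ε₂, hε₂, h₂⟩ := BFredholm.exists_nullity_sub_algebraMap hreg hee he
  obtain ⟨ε₃, hε₃, h₃⟩ := BFredholm.exists_defect_sub_algebraMap hreg hff hf
  refine ⟨min ε₁ (min ε₂ ε₃), by positivity, N, _, _, fun m hm => ⟨?_, ?_⟩, ?_, ?_,
    fun z hz hzε => ⟨h₁ z hz (hzε.trans_le (min_le_left _ _)),
      h₂ z hz (hzε.trans_le ((min_le_right _ _).trans (min_le_left _ _))),
      h₃ z hz (hzε.trans_le ((min_le_right _ _).trans (min_le_right _ _)))⟩⟩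
  · congr 1
    ext a
    exact (he m hm a).symm.trans (he N le_rfl a)
  · congr 1
    ext a
    exact (hf m hm a).symm.trans (hf N le_rfl a)
  -- Left multiplication by `e` maps `R(x)` onto `eA`: its image lies in `eA`, and `eA` is contained
  -- in `R(x)` and fixed by `e`.
  · refine BFredholm.order_le_of_range_eq
      ((DistribSMul.toLinearMap Aᵐᵒᵖ A e).domRestrict (BFredholm.rightAnn x)) ?_
    ext a
    refine Iff.trans ⟨?_, fun ha => ⟨⟨a, ((he N le_rfl a).1 ha).1⟩, ha⟩⟩ (he N le_rfl a)
    rintro ⟨v, rfl⟩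
    change e * (e * (v : A)) = e * v
    rw [← mul_assoc, hee]
  · refine BFredholm.order_le_of_range_eq
      ((LinearMap.toSpanSingleton A A f).domRestrict (BFredholm.leftAnn x)) ?_
    ext a
    refine Iff.trans ⟨?_, fun ha => ⟨⟨a, ((hf N le_rfl a).1 ha).1⟩, ha⟩⟩ (hf N le_rfl a)
    rintro ⟨v, rfl⟩
    change (v : A) * f * f = v * f
    rw [mul_assoc, hff]
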